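/- Let $\mathbb{F}$ be a division ring, $n \ge 1$ an integer, $\sigma : \mathbb{F} \to \mathbb{F}^{n\times n}$ a (unital) ring morphism, $\delta : \mathbb{F} \to \mathbb{F}^n$ a $\sigma$-derivation (an additive map with $\delta(bc) = \sigma(b)\delta(c) + \delta(b)c$ for all $b, c \in \mathbb{F}$), and $\mathbf{a} \in \mathbb{F}^n$. Put $\mathcal{D}_\mathbf{a}(\beta) = \sigma(\beta)\mathbf{a} + \delta(\beta) \in \mathbb{F}^n$ for $\beta \in \mathbb{F}$, and let $K = K_\mathbf{a} = \{\beta \in \mathbb{F} \mid \mathcal{D}_\mathbf{a}(\beta) = \mathbf{a}\beta\}$, a division subring of $\mathbb{F}$; the pair $K \subseteq \mathbb{F}$ is called a P-Galois extension, and it is called finite if the right dimension $\dim^R_K(\mathbb{F})$ is finite. Let $\mathcal{M}$ be the free monoid on $x_1, \ldots, x_n$, and define operators $\mathcal{D}_\mathbf{a}^{\mathfrak{m}} : \mathbb{F} \to \mathbb{F}$ for $\mathfrak{m} \in \mathcal{M}$ recursively by $\mathcal{D}_\mathbf{a}^{1} = \mathrm{Id}$ and $\mathcal{D}_\mathbf{a}^{x_i\mathfrak{m}}(\beta)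 = $ the $i$-th component of $\mathcal{D}_\mathbf{a}(\mathcal{D}_\mathbf{a}^{\mathfrak{m}}(\beta))$. Let $\mathcal{D}_\mathbf{a}^{\mathcal{M}} = \{\mathcal{D}_\mathbf{a}^{\mathfrak{m}} \mid \mathfrak{m} \in \mathcal{M}\}$, a set of maps $\mathbb{F} \to \mathbb{F}$, and let $\mathbb{F}[\mathcal{D}_\mathbf{a}]$ be the left $\mathbb{F}$-vector space of maps $\mathbb{F} \to \mathbb{F}$ spanned by $\mathcal{D}_\mathbf{a}^{\mathcal{M}}$. Then the P-Galois extension $K \subseteq \mathbb{F}$ is finite if, and only if, $\mathbb{F}[\mathcal{D}_\mathbf{a}]$ has finite left dimension over $\mathbb{F}$, in which case $\dim^L_{\mathbb{F}}(\mathbb{F}[\mathcal{D}_\mathbf{a}]) = \dim^R_{K}(\mathbb{F})$. Moreover, the elements of $\mathcal{D}_\mathbf{a}^{\mathcal{M}}$ are right $K$-linear maps, and if the set $\mathcal{D}_\mathbf{a}^{\mathcal{M}}$ is finite, then $K \subseteq \mathbb{F}$ is finite and $\dim^R_K(\mathbb{F}) \le |\mathcal{D}_\mathbf{a}^{\mathcal{M}}|$.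 -/

import Mathlib

/-! # Linearized multivariate skew polynomials and P-Galois extensions of division rings -/

namespace PGalois

open Matrix

/-- A `σ`-derivation `δ : F → Fⁿ` for a ring morphism `σ : F → Fⁿˣⁿ`: an additive map with
`δ (a b) = σ(a) δ(b) + δ(a) b`. -/
structure SkewDerivation {F : Type*} [DivisionRing F] {n : ℕ}
    (σ : F →+* Matrix (Fin n) (Fin n) F) extends F →+ (Fin n → F) where
  leibniz' : ∀ b c : F, toFun (b * c) = σ b *ᵥ toFun c + fun i => toFun b i * c

section

variable {F : Type*} [DivisionRing F] {n : ℕ} {σ : F →+* Matrix (Fin n) (Fin n) F}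

instance : CoeFun (SkewDerivation σ) (fun _ => F → (Fin n → F)) := ⟨fun δ => δ.toFun⟩

/-- The operator `D_a : F → Fⁿ`, `D_a(β) = σ(β) a + δ(β)`. -/
def vecOp (δ : SkewDerivation σ) (a : Fin n → F) (β : F) : Fin n → F :=
  σ β *ᵥ a + δ β

theorem vecOp_add (δ : SkewDerivation σ) (a : Fin n → F) (β γ : F) :
    vecOp δ a (β + γ) = vecOp δ a β + vecOp δ a γ := by
  have h : δ (β + γ) = δ β + δ γ := δ.map_add' β γ
  simp only [vecOp, map_add, Matrix.add_mulVec, h]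
  abel

theorem vecOp_zero (δ : SkewDerivation σ) (a : Fin n → F) : vecOp δ a 0 = 0 := by
  have h : δ 0 = 0 := δ.map_zero'
  simp [vecOp, h]

theorem vecOp_one (δ : SkewDerivation σ) (a : Fin n → F) : vecOp δ a 1 = a := by
  have h : δ 1 = 0 := by
    have h1 : δ (1 * 1) = σ 1 *ᵥ δ 1 + fun i => δ 1 i * 1 := δ.leibniz' 1 1
    simpa using h1
  simp [vecOp, h]

/-- The operators `D_a` commute with right multiplication by `γ` whenever `D_a(γ) = a γ`. -/
theorem vecOp_mul (δ : SkewDerivation σ) (a : Fin n → F) (β γ : F)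
    (hγ : vecOp δ a γ = fun i => a i * γ) :
    vecOp δ a (β * γ) = fun i => vecOp δ a β i * γ := by
  have h : δ (β * γ) = σ β *ᵥ δ γ + fun i => δ β i * γ := δ.leibniz' β γ
  have h2 : vecOp δ a (β * γ) = σ β *ᵥ vecOp δ a γ + fun i => δ β i * γ := by
    simp only [vecOp, h, map_mul, Matrix.mulVec_add, ← Matrix.mulVec_mulVec, add_assoc]
  rw [h2, hγ]
  funext i
  simp [vecOp, Matrix.mulVec, dotProduct, add_mul, Finset.sum_mul, mul_assoc]

/-- The centralizer `K_a = {β ∈ F | D_a(β) = a β}`, a division subring of `F`. -/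
def centralizer (δ : SkewDerivation σ) (a : Fin n → F) : Subfield F where
  carrier := {β | vecOp δ a β = fun i => a i * β}
  mul_mem' := by
    intro β γ hβ hγ
    simp only [Set.mem_ofPred_eq] at hβ hγ ⊢
    rw [vecOp_mul δ a β γ hγ, hβ]
    funext i
    simp [mul_assoc]
  one_mem' := by simp [vecOp_one]
  add_mem' := by
    intro β γ hβ hγ
    simp only [Set.mem_ofPred_eq] at hβ hγ ⊢
    rw [vecOp_add, hβ, hγ]
    funext i
    simp [mul_add]
  zero_mem' := by
    simp only [Set.mem_ofPred_eq, vecOp_zero, mul_zero]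
    rfl
  neg_mem' := by
    intro β hβ
    simp only [Set.mem_ofPred_eq] at hβ ⊢
    have h := vecOp_add δ a β (-β)
    rw [add_neg_cancel, vecOp_zero, hβ] at h
    rw [eq_neg_of_add_eq_zero_right h.symm]
    funext i
    simp
  inv_mem' := by
    intro β hβ
    simp only [Set.mem_ofPred_eq] at hβ ⊢
    by_cases h0 : β = 0
    · subst h0
      simpa using hβ
    · have h := vecOp_mul δ a β⁻¹ β hβ
      rw [inv_mul_cancel₀ h0, vecOp_one] at h
      funext i
      exact (eq_mul_inv_iff_mul_eq₀ h0).mpr (congrFun h i).symm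

/-- The operator `D_a^m : F → F` of a monomial `m` in the free monoid on `x₁, …, xₙ`:
`D_a^1 = Id`, and `D_a^(x_i m)` is the `i`-th component of `D_a ∘ D_a^m`. -/
def monOp (δ : SkewDerivation σ) (a : Fin n → F) (m : FreeMonoid (Fin n)) (β : F) : F :=
  m.toList.foldr (fun i γ => vecOp δ a γ i) β

theorem monOp_one (δ : SkewDerivation σ) (a : Fin n → F) : monOp δ a 1 = id := rfl

theorem monOp_of_mul (δ : SkewDerivation σ) (a : Fin n → F) (i : Fin n)
    (m : FreeMonoid (Fin n)) (β : F) :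
    monOp δ a (FreeMonoid.of i * m) β
      = (σ (monOp δ a m β) *ᵥ a + δ (monOp δ a m β)) i := rfl

/-- The set of operators `D_a^M = {D_a^m | m a monomial}`. -/
def monOps (δ : SkewDerivation σ) (a : Fin n → F) : Set (F → F) :=
  Set.range (monOp δ a)

/-- The left `F`-vector space `F[D_a]` of linearized polynomials: the left span of `D_a^M`
inside the maps `F → F`, where `(c • f)(β) = c * f(β)`. -/
def linPoly (δ : SkewDerivation σ) (a : Fin n → F) : Submodule F (F → F) :=
  Submodule.span F (monOps δ a)

/-- `K ⊆ F` is the P-Galois extension given by `n ≥ 1`, `σ`, `δ` and `a`: `K = K_a`. -/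
structure IsPGaloisExtension (K : Subfield F) (δ : SkewDerivation σ) (a : Fin n → F) :
    Prop where
  pos : 0 < n
  eq_centralizer : K = centralizer δ a

/-- The scalars acting on `F` from the right through `K`, as a subring of `Fᵐᵒᵖ`. An
`F`-module over this ring is a right `K`-vector space. -/
abbrev rightScalars (K : Subfield F) : Subring Fᵐᵒᵖ := K.toSubring.op

theorem rightScalars_smul (K : Subfield F) (c : F) (hc : c ∈ K) (β : F) :
    (⟨MulOpposite.op c, hc⟩ : rightScalars K) • β = β * c := rfl

/-- `K ⊆ F` is finite: `F` has finite right dimension over `K`. -/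
def IsFiniteExtension (K : Subfield F) : Prop := Module.Finite (rightScalars K) F

/-- The right dimension of `F` over `K` (used only when it is finite). -/
noncomputable def rightDim (K : Subfield F) : ℕ := Module.finrank (rightScalars K) F

end

end PGalois

namespace PGalois

open Matrix

/-! An Artin–Dedekind argument: evaluating `F[D_a]` at right `K`-independent points is surjective,
so the number of such points is at most the left dimension of `F[D_a]`. On a finite right `K`-basis
evaluation is also injective, since the operators are right `K`-linear; hence the dimensions agree.
Surjectivity dualizes to `eq_zero_of_sum_monOp_mul_eq_zero`, proved by shortening a relation:
applying `D_a` replaces its coefficients `e j` by the defects `D_a(e j) - a e j`, which vanish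
exactly when `e j` lies in `K`. -/

/-- Functionals separate points of a vector space whose scalar action is given as a ring morphism
into additive endomorphisms. -/
theorem exists_twisted_functional_ne_zero {F M : Type*} [DivisionRing F] [AddCommGroup M]
    (ρ : F →+* AddMonoid.End M) {v : M} (hv : v ≠ 0) :
    ∃ φ : M →+ F, (∀ b w, φ (ρ b w) = b * φ w) ∧ φ v ≠ 0 := by
  let : Module F M := Module.compHom M ρ
  let B := Module.Basis.ofVectorSpace F M
  have hB : B.repr v ≠ 0 := fun h => hv (by simpa using h)
  obtain ⟨i, hi⟩ := Finsupp.ne_iff.mp hB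
  refine ⟨(B.coord i).toAddMonoidHom, fun b w => ?_, hi⟩
  exact (B.coord i).map_smul b w

section

variable {F : Type*} [DivisionRing F] {n : ℕ} {σ : F →+* Matrix (Fin n) (Fin n) F}

/-- The left action of `F` on `Fⁿ` through `σ`. -/
def twistedAction (σ : F →+* Matrix (Fin n) (Fin n) F) : F →+* AddMonoid.End (Fin n → F) where
  toFun b := AddMonoidHom.mk' (fun v => σ b *ᵥ v) (fun v w => Matrix.mulVec_add _ v w)
  map_one' := by ext1 v; exact (congrArg (· *ᵥ v) (map_one σ)).trans (Matrix.one_mulVec v)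
  map_mul' b c := by ext1 v; exact (congrArg (· *ᵥ v) (map_mul σ b c)).trans (Matrix.mulVec_mulVec _ _ _).symm
  map_zero' := by ext1 v; exact (congrArg (· *ᵥ v) (map_zero σ)).trans (Matrix.zero_mulVec v)
  map_add' b c := by ext1 v; exact (congrArg (· *ᵥ v) (map_add σ b c)).trans (Matrix.add_mulVec _ _ _)

theorem vecOp_sum {ι : Type*} (δ : SkewDerivation σ) (a : Fin n → F) (s : Finset ι) (f : ι → F) :
    vecOp δ a (∑ j ∈ s, f j) = ∑ j ∈ s, vecOp δ a (f j) :=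
  map_sum (AddMonoidHom.mk' (vecOp δ a) (vecOp_add δ a)) f s

/-- The product rule for `D_a` with no assumption on the right factor. -/
theorem vecOp_mul_eq (δ : SkewDerivation σ) (a : Fin n → F) (b c : F) :
    vecOp δ a (b * c) =
      σ b *ᵥ (vecOp δ a c - fun i => a i * c) + fun i => vecOp δ a b i * c := by
  have h : δ (b * c) = σ b *ᵥ δ c + fun i => δ b i * c := δ.leibniz' b c
  funext i
  simp [vecOp, h, Matrix.mulVec_add, Matrix.mulVec_sub, add_mul, ← Matrix.mulVec_mulVec,
    Matrix.mulVec, dotProduct, Finset.sum_mul, mul_assoc]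
  abel

theorem monOp_add (δ : SkewDerivation σ) (a : Fin n → F) (m : FreeMonoid (Fin n)) (β γ : F) :
    monOp δ a m (β + γ) = monOp δ a m β + monOp δ a m γ := by
  induction m using FreeMonoid.inductionOn' with
  | one => rfl
  | of_mul i m ih =>
    change vecOp δ a (monOp δ a m (β + γ)) i = _
    rw [ih, vecOp_add]; rfl

theorem monOp_mul (δ : SkewDerivation σ) (a : Fin n → F) (m : FreeMonoid (Fin n)) (β : F) {γ : F}
    (hγ : γ ∈ centralizer δ a) : monOp δ a m (β * γ) = monOp δ a m β * γ := by
  induction m using FreeMonoid.inductionOn' with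
  | one => rfl
  | of_mul i m ih =>
    change vecOp δ a (monOp δ a m (β * γ)) i = _
    rw [ih, vecOp_mul δ a _ _ hγ]; rfl

/-- The monomial operators detect right linear independence over the centralizer. -/
theorem eq_zero_of_sum_monOp_mul_eq_zero {ι : Type*} [Fintype ι] (δ : SkewDerivation σ)
    (a : Fin n → F) {β : ι → F} (hβ : LinearIndependent (rightScalars (centralizer δ a)) β)
    (c : ι → F) (hc : ∀ m, ∑ j, monOp δ a m (β j) * c j = 0) : c = 0 := by
  classical
  induction hk : (Finset.univ.filter (c · ≠ 0)).card using Nat.strong_induction_on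
    generalizing c with
  | _ k ih =>
  by_contra hne
  obtain ⟨j₀, hj₀⟩ := Function.ne_iff.mp hne
  rw [Pi.zero_apply] at hj₀
  -- Scaling one coefficient to `1` makes its defect zero, because `D_a(1) = a`.
  set e : ι → F := fun j => c j * (c j₀)⁻¹ with he
  have hej₀ : e j₀ = 1 := mul_inv_cancel₀ hj₀
  have hsum (m) : ∑ j, monOp δ a m (β j) * e j = 0 := by
    simp_rw [he, ← mul_assoc, ← Finset.sum_mul, hc, zero_mul]
  let d : ι → Fin n → F := fun j => vecOp δ a (e j) - fun i => a i * e j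
  have hd (m) : ∑ j, σ (monOp δ a m (β j)) *ᵥ d j = 0 := by
    have h := congrArg (vecOp δ a) (hsum m)
    rw [vecOp_sum, vecOp_zero] at h
    simp_rw [vecOp_mul_eq] at h
    rw [Finset.sum_add_distrib] at h
    -- The untwisted terms of the product rule are, in coordinate `i`, the relation for the monomial
    -- `x_i m`.
    have h2 : ∑ j, (fun i => vecOp δ a (monOp δ a m (β j)) i * e j) = 0 := by
      funext i
      rw [Finset.sum_apply]
      exact hsum (FreeMonoid.of i * m)
    rwa [h2, add_zero] at h
  have hd0 (j) : d j = 0 := by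
    by_contra hdj
    -- A functional linear for the action through `σ` turns the vector relation into a scalar one of
    -- the original form, with the index `j₀` lost from its support.
    obtain ⟨φ, hφ, hφj⟩ := exists_twisted_functional_ne_zero (twistedAction σ) hdj
    have hz : (fun j => φ (d j)) = 0 := by
      refine ih _ ?_ (fun j => φ (d j)) (fun m => ?_) rfl
      · rw [← hk]
        refine Finset.card_lt_card (Finset.ssubset_iff_of_subset ?_ |>.mpr ⟨j₀, ?_, ?_⟩)
        · intro i hi
          rw [Finset.mem_filter] at hi ⊢
          refine ⟨Finset.mem_univ _, fun h0 => hi.2 ?_⟩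
          have : d i = 0 := by
            funext l
            simp [d, he, h0, vecOp_zero]
          rw [this, map_zero]
        · simpa using hj₀
        · have : d j₀ = 0 := by
            funext l
            simp [d, hej₀, vecOp_one]
          simp [this]
      · have h := congrArg φ (hd m)
        rw [map_sum, map_zero] at h
        rw [← h]
        exact Finset.sum_congr rfl fun j _ => (hφ _ _).symm
    exact hφj (congrFun hz j)
  have hmem (j) : e j ∈ centralizer δ a := sub_eq_zero.mp (hd0 j)
  -- All coefficients now lie in `K`, so the relation for the monomial `1` contradicts independence.
  have h1 := Fintype.linearIndependent_iff.mp hβ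
    (fun j => ⟨MulOpposite.op (e j), hmem j⟩) (hsum 1) j₀
  have h2 : e j₀ = 0 := congrArg (fun x : rightScalars (centralizer δ a) => MulOpposite.unop x.1) h1
  exact one_ne_zero (hej₀.symm.trans h2)

/-- Evaluation of linearized polynomials at a family of points. -/
def linPolyEval {ι : Type*} (δ : SkewDerivation σ) (a : Fin n → F) (β : ι → F) :
    linPoly δ a →ₗ[F] (ι → F) :=
  (LinearMap.funLeft F F β).comp (linPoly δ a).subtype

/-- A nonzero functional on `F^ι` killing the range would have coordinates satisfying the relation
for every monomial. -/
theorem linPolyEval_surjective {ι : Type*} [Finite ι] (δ : SkewDerivation σ)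
    (a : Fin n → F) {β : ι → F} (hβ : LinearIndependent (rightScalars (centralizer δ a)) β) :
    Function.Surjective (linPolyEval δ a β) := by
  classical
  have := Fintype.ofFinite ι
  rw [← LinearMap.range_eq_top]
  by_contra hne
  obtain ⟨g, hg0, hg⟩ := Submodule.exists_le_ker_of_lt_top _ (lt_top_iff_ne_top.mpr hne)
  have hgv (v : ι → F) : g v = ∑ j, v j * g (Pi.single j 1) := by
    conv_lhs => rw [pi_eq_sum_univ' v]
    simp [map_sum]
  have h0 := eq_zero_of_sum_monOp_mul_eq_zero δ a hβ (fun j => g (Pi.single j 1)) fun m => by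
    have h := hg ⟨⟨monOp δ a m, Submodule.subset_span ⟨m, rfl⟩⟩, rfl⟩
    rw [LinearMap.mem_ker, hgv] at h
    exact h
  refine hg0 (LinearMap.ext fun v => ?_)
  rw [hgv]
  exact Finset.sum_eq_zero fun j _ => by rw [congrFun h0 j, Pi.zero_apply, mul_zero]

theorem isLinearMap_monOp (δ : SkewDerivation σ) (a : Fin n → F) (m : FreeMonoid (Fin n)) :
    IsLinearMap (rightScalars (centralizer δ a)) (monOp δ a m) where
  map_add := monOp_add δ a m
  map_smul c β := monOp_mul δ a m β c.2

theorem isLinearMap_of_mem_linPoly (δ : SkewDerivation σ) (a : Fin n → F) {f : F → F}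
    (hf : f ∈ linPoly δ a) : IsLinearMap (rightScalars (centralizer δ a)) f := by
  induction hf using Submodule.span_induction with
  | mem f hf => obtain ⟨m, rfl⟩ := hf; exact isLinearMap_monOp δ a m
  | zero => exact (0 : F →ₗ[rightScalars (centralizer δ a)] F).isLinear
  | add f g _ _ hf hg => exact (hf.mk' f + hg.mk' g).isLinear
  | smul b f _ hf =>
    exact ⟨fun x y => by simp [hf.map_add, mul_add], fun c x => by
      simp only [Pi.smul_apply, hf.map_smul]
      exact (mul_assoc b (f x) _).symm⟩

theorem linPolyEval_injective {ι : Type*} (δ : SkewDerivation σ) (a : Fin n → F)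
    (β : Module.Basis ι (rightScalars (centralizer δ a)) F) :
    Function.Injective (linPolyEval δ a β) := by
  intro f g hfg
  have h : (isLinearMap_of_mem_linPoly δ a f.2).mk' _ =
      (isLinearMap_of_mem_linPoly δ a g.2).mk' _ := β.ext fun i => congrFun hfg i
  exact Subtype.ext (congrArg DFunLike.coe h)

/-- The ring of right scalars of a division subring is a division ring. -/
noncomputable abbrev rightScalarsDivisionRing (K : Subfield F) :
    DivisionRing (rightScalars K) :=
  DivisionRing.ofIsUnitOrEqZero fun c => by
    refine or_iff_not_imp_right.mpr fun hc => ?_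
    have h0 : c.1 ≠ 0 := fun h => hc (Subtype.ext h)
    exact ⟨⟨c, ⟨c.1⁻¹, K.inv_mem c.2⟩, Subtype.ext (mul_inv_cancel₀ h0),
      Subtype.ext (inv_mul_cancel₀ h0)⟩, rfl⟩

/-- Surjectivity at every finite independent set bounds its size by the left dimension of `F[D_a]`.
-/
theorem isFiniteExtension_of_finite_linPoly (δ : SkewDerivation σ) (a : Fin n → F)
    [Module.Finite F (linPoly δ a)] : IsFiniteExtension (centralizer δ a) := by
  let := rightScalarsDivisionRing (centralizer δ a)
  have h : Module.rank (rightScalars (centralizer δ a)) F ≤ Module.finrank F (linPoly δ a) :=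
    rank_le fun s hs => by
      simpa using LinearMap.finrank_le_finrank_of_surjective (linPolyEval_surjective δ a hs)
  exact Module.rank_lt_aleph0_iff.mp (h.trans_lt Cardinal.natCast_lt_aleph0)

theorem finite_linPoly_and_finrank_eq (δ : SkewDerivation σ) (a : Fin n → F)
    (h : IsFiniteExtension (centralizer δ a)) :
    Module.Finite F (linPoly δ a) ∧
      Module.finrank F (linPoly δ a) = rightDim (centralizer δ a) := by
  let := rightScalarsDivisionRing (centralizer δ a)
  have : Module.Finite (rightScalars (centralizer δ a)) F := h
  let β := Module.finBasis (rightScalars (centralizer δ a)) F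
  let e := LinearEquiv.ofBijective (linPolyEval δ a β)
    ⟨linPolyEval_injective δ a β, linPolyEval_surjective δ a β.linearIndependent⟩
  refine ⟨Module.Finite.equiv e.symm, ?_⟩
  rw [e.finrank_eq, Module.finrank_fin_fun]
  rfl

end

end PGalois

theorem mainTheorem9 {F : Type*} [DivisionRing F] {n : ℕ}
    (σ : F →+* Matrix (Fin n) (Fin n) F) (δ : PGalois.SkewDerivation σ) (a : Fin n → F)
    (K : Subfield F) (hK : PGalois.IsPGaloisExtension K δ a) :
    (PGalois.IsFiniteExtension K ↔ Module.Finite F (PGalois.linPoly δ a)) ∧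
    (PGalois.IsFiniteExtension K →
      Module.finrank F (PGalois.linPoly δ a) = PGalois.rightDim K) ∧
    (∀ f ∈ PGalois.monOps δ a, IsLinearMap (PGalois.rightScalars K) f) ∧
    ((PGalois.monOps δ a).Finite →
      PGalois.IsFiniteExtension K ∧ PGalois.rightDim K ≤ (PGalois.monOps δ a).ncard) := by
  obtain rfl := hK.eq_centralizer
  refine ⟨⟨fun h => (PGalois.finite_linPoly_and_finrank_eq δ a h).1,
    fun _ => PGalois.isFiniteExtension_of_finite_linPoly δ a⟩,
    fun h => (PGalois.finite_linPoly_and_finrank_eq δ a h).2, ?_, fun hfin => ?_⟩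
  · rintro _ ⟨m, rfl⟩
    exact PGalois.isLinearMap_monOp δ a m
  · have : Module.Finite F (PGalois.linPoly δ a) := Module.Finite.span_of_finite F hfin
    have h := PGalois.isFiniteExtension_of_finite_linPoly δ a
    refine ⟨h, ?_⟩
    rw [← (PGalois.finite_linPoly_and_finrank_eq δ a h).2]
    have := hfin.fintype
    rw [Set.ncard_eq_toFinset_card']
    exact finrank_span_le_card (PGalois.monOps δ a)
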